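/- Let $W=(W_t)_{t\ge 0}$ be a standard Brownian motion under a probability measure $\mathbf P$, let $\sigma>0$, and let $N_t=\exp(2\sigma W_t-2\sigma^2 t)$, $t\ge 0$. Let $$g=\sup\Big\{t\ge 0:\ N_t=\sup_{s\ge 0}N_s\Big\}=\sup\Big\{t\ge 0:\ W_t-\sigma t=\sup_{s\ge 0}(W_s-\sigma s)\Big\}$$ be the time of the global maximum of $N$. Then, almost surely, the global maximum of $N$ is attained and the set of times at which it is attained is bounded, so that $g$ is an almost surely well-defined random variable with values in $[0,\infty)$, and its Laplace transform is $$\mathbf E\big[e^{-\lambda g}\big]=\frac{2}{1+\sqrt{1+\frac{2\lambda}{\sigma^2}}}\qquad\text{for all }\lambda\ge 0.$$ Moreover, this characterizes the law of $g$: it is the only probability measure on $[0,\infty)$ with this Laplace transform on $\{\lambda\ge 0\}$. -/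

import Mathlib

open MeasureTheory ProbabilityTheory
open scoped NNReal

/-- The geometric Brownian motion `N_t = exp (2 σ W_t - 2 σ² t)`, `t ≥ 0`, driven by `W`. -/
noncomputable def geomBM {Ω : Type*} (σ : ℝ) (W : ℝ≥0 → Ω → ℝ) (t : ℝ≥0) (ω : Ω) : ℝ :=
  Real.exp (2 * σ * W t ω - 2 * σ ^ 2 * (t : ℝ))

/-- The set of times `t ≥ 0` at which the path of `X` attains its global supremum,
`{t ≥ 0 : X_t = sup_{s ≥ 0} X_s}`. -/
def maxTimes {Ω : Type*} (X : ℝ≥0 → Ω → ℝ) (ω : Ω) : Set ℝ≥0 :=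
  {t | IsLUB (Set.range fun s : ℝ≥0 => X s ω) (X t ω)}

/-- The (last) time of the global maximum, `sup {t ≥ 0 : X_t = sup_{s ≥ 0} X_s}`.
This is the genuine supremum at every `ω` at which `maxTimes X ω` is nonempty and bounded. -/
noncomputable def timeOfMax {Ω : Type*} (X : ℝ≥0 → Ω → ℝ) (ω : Ω) : ℝ≥0 :=
  sSup (maxTimes X ω)

open Filter Set Topology
open scoped ENNReal BoundedContinuousFunction

/-! Since `N_t = exp (2σ Y_t)` with `Y_t = W_t - σ t`, the time `g` is the last maximizer of `Y`.
Then `g < t` exactly when the rise of `Y` above `Y_t` after `t` is smaller than the maximum of `Y -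
Y_t` on `[0, t]`. The two quantities are independent. The first is exponential of rate `2σ`; by time
reversal the second has the law of the maximum of `W_s + σ s` over `s ≤ t`
(`measure_sSup_argmaxSet_lt`).

Now let `t` be an independent exponential time of rate `l`. Then `E exp (-l g)` is the probability
that `g < t`. The reversed maximum exceeds `a` with probability `E exp (-l T_a) = exp (-θ a)`, where
`T_a` is a hitting time and `l = θ σ + θ² / 2` (`integral_exp_hitTime`, optional stopping of an
exponential martingale). Averaging over the exponential variable `a` gives `2σ / (2σ + θ)`, and
solving for `θ` gives the formula. The same hitting formula with drift `-σ` and `l = 0` yields the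
law of the future rise. Uniqueness comes from the separating algebra spanned by the functions `x ↦
exp (-l x)`. -/

/-- A Brownian motion all of whose paths are continuous and start at `0`, and all of whose
coordinates are measurable. -/
structure IsRegularBrownian {Ω : Type*} [MeasurableSpace Ω] (W : ℝ≥0 → Ω → ℝ)
    (P : Measure Ω) : Prop where
  isPreBrownianReal : IsPreBrownianReal W P
  measurable : ∀ t, Measurable (W t)
  continuous : ∀ ω, Continuous fun t => W t ω
  zero : ∀ ω, W 0 ω = 0

/-! ### Exponential martingales -/

/-- The filtration generated by a measurable process. -/
def pastFiltration {Ω : Type*} [m : MeasurableSpace Ω] {W : ℝ≥0 → Ω → ℝ}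
    (hm : ∀ t, Measurable (W t)) : Filtration ℝ≥0 m where
  seq t := MeasurableSpace.comap (fun ω (s : Set.Iic t) => W s ω) inferInstance
  mono' s t hst := by
    rintro _ ⟨A, hA, rfl⟩
    refine ⟨(fun x (r : Set.Iic s) => x ⟨r, r.2.trans hst⟩) ⁻¹' A, ?_, rfl⟩
    exact (measurable_pi_lambda _ fun r => measurable_pi_apply _) hA
  le' t := by
    rintro _ ⟨A, hA, rfl⟩
    exact (measurable_pi_lambda (fun ω (s : Set.Iic t) => W s ω) fun r => hm r) hA

/-- The exponential martingale `exp (θ W_t - θ² t / 2)`. -/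
noncomputable def expBM {Ω : Type*} (θ : ℝ) (W : ℝ≥0 → Ω → ℝ) (t : ℝ≥0) (ω : Ω) : ℝ :=
  Real.exp (θ * W t ω - θ ^ 2 / 2 * t)

section

variable {Ω : Type*} [mΩ : MeasurableSpace Ω] {P : Measure Ω} {W : ℝ≥0 → Ω → ℝ}

lemma measurable_pastFiltration (hm : ∀ t, Measurable (W t)) {s t : ℝ≥0} (hst : s ≤ t) :
    Measurable[pastFiltration hm t] (W s) := by
  rintro A hA
  exact ⟨(fun x => x ⟨s, hst⟩) ⁻¹' A, measurable_pi_apply _ hA, rfl⟩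

lemma IsPreBrownianReal.integrable_exp_mul (hW : IsPreBrownianReal W P) (θ : ℝ) (t : ℝ≥0) :
    Integrable (fun ω => Real.exp (θ * W t ω)) P := by
  have h := integrable_exp_mul_gaussianReal (μ := 0) (v := t) θ
  rw [← (hW.hasLaw_eval t).map_eq] at h
  exact h.comp_aemeasurable (hW.hasLaw_eval t).aemeasurable

lemma IsPreBrownianReal.integral_exp_mul (hW : IsPreBrownianReal W P) (θ : ℝ) (t : ℝ≥0) :
    ∫ ω, Real.exp (θ * W t ω) ∂P = Real.exp (t * θ ^ 2 / 2) := by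
  have h := mgf_gaussianReal (hW.hasLaw_eval t).map_eq θ
  simpa [mgf] using h

lemma integrable_expBM (hW : IsPreBrownianReal W P) (θ : ℝ) (t : ℝ≥0) :
    Integrable (expBM θ W t) P := by
  unfold expBM
  simp_rw [Real.exp_sub, div_eq_mul_inv]
  exact (IsPreBrownianReal.integrable_exp_mul hW θ t).mul_const _

lemma integral_expBM (hW : IsPreBrownianReal W P) (θ : ℝ) (t : ℝ≥0) :
    ∫ ω, expBM θ W t ω ∂P = 1 := by
  unfold expBM
  simp_rw [Real.exp_sub, div_eq_mul_inv]
  rw [integral_mul_const, IsPreBrownianReal.integral_exp_mul hW, ← Real.exp_neg, ← Real.exp_add]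
  simp; ring

namespace IsRegularBrownian

lemma isProbabilityMeasure (hW : IsRegularBrownian W P) : IsProbabilityMeasure P :=
  hW.isPreBrownianReal.isGaussianProcess.isProbabilityMeasure

lemma measurable_expBM (hW : IsRegularBrownian W P) (θ : ℝ) {s t : ℝ≥0} (hst : s ≤ t) :
    Measurable[pastFiltration hW.measurable t] (expBM θ W s) := by
  have := measurable_pastFiltration hW.measurable hst
  unfold expBM
  exact Real.measurable_exp.comp ((this.const_mul θ).sub_const _)

/-- The value at `s + u` is the value at `s` times the same functional of the path shifted by `s`;
the latter factor is independent of the past and has mean one. -/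
lemma martingale_expBM (hW : IsRegularBrownian W P) (θ : ℝ) :
    Martingale (expBM θ W) (pastFiltration hW.measurable) P := by
  have := hW.isProbabilityMeasure
  refine ⟨fun t => (hW.measurable_expBM θ le_rfl).stronglyMeasurable, fun s t hst => ?_⟩
  let V : ℝ≥0 → Ω → ℝ := fun u ω => W (s + u) ω - W s ω
  have hV : IsPreBrownianReal V P := hW.isPreBrownianReal.shift s
  obtain ⟨u, rfl⟩ := exists_add_of_le hst
  have hmul : expBM θ W (s + u) = expBM θ W s * expBM θ V u := by
    ext ω
    simp only [expBM, Pi.mul_apply, ← Real.exp_add, V]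
    congr 1
    push_cast
    ring
  have hint : Integrable (expBM θ V u) P := integrable_expBM hV θ u
  have h1 : P[expBM θ W s * expBM θ V u | pastFiltration hW.measurable s] =ᵐ[P]
      expBM θ W s * P[expBM θ V u | pastFiltration hW.measurable s] := by
    refine condExp_mul_of_stronglyMeasurable_left
      (hW.measurable_expBM θ le_rfl).stronglyMeasurable ?_ hint
    rw [← hmul]
    exact integrable_expBM hW.isPreBrownianReal θ _
  have h2 : P[expBM θ V u | pastFiltration hW.measurable s] =ᵐ[P] fun _ => P[expBM θ V u] := by
    refine condExp_indep_eq (m₁ := MeasurableSpace.comap (fun ω u => V u ω) inferInstance)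
      ?_ ((pastFiltration hW.measurable).le s) ?_ ?_
    · rintro _ ⟨A, hA, rfl⟩
      exact (measurable_pi_lambda _ fun r =>
        (hW.measurable _).sub (hW.measurable _)) hA
    · refine Measurable.stronglyMeasurable ?_
      have : Measurable[MeasurableSpace.comap (fun ω u => V u ω) inferInstance] (V u) := by
        rintro A hA
        exact ⟨(fun x => x u) ⁻¹' A, measurable_pi_apply _ hA, rfl⟩
      exact Real.measurable_exp.comp ((this.const_mul θ).sub_const _)
    · exact hW.isPreBrownianReal.indepFun_shift s
  rw [hmul]
  filter_upwards [h1, h2] with ω h1 h2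
  rw [h1, Pi.mul_apply, h2, integral_expBM hV, mul_one]

end IsRegularBrownian

end

/-! ### Hitting times and optional stopping -/

/-- The first time in the finite set `G` at which `f` exceeds `a`, or `N` if there is none
before `N`. -/
noncomputable def gridHit (f : ℝ≥0 → ℝ) (a : ℝ) (N : ℝ≥0) (G : Finset ℝ≥0) : ℝ≥0 :=
  open Classical in ((insert N G).filter fun s => s = N ∨ a < f s).min' ⟨N, by simp⟩

/-- The minimum of `N` and the first time at which `f` exceeds `a`. -/
noncomputable def truncHit (f : ℝ≥0 → ℝ) (a : ℝ) (N : ℝ≥0) : ℝ≥0 :=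
  sInf {s | s ≤ N ∧ (s = N ∨ a < f s)}

/-- The first time at which `f` exceeds `a`. -/
noncomputable def hitTime (f : ℝ≥0 → ℝ) (a : ℝ) : ℝ≥0 := sInf {s | a < f s}

/-- The first `n` points of a dense sequence, truncated at `N`. -/
noncomputable def denseGrid (N : ℝ≥0) (n : ℕ) : Finset ℝ≥0 :=
  open Classical in
  (Finset.range n).image fun i => min (TopologicalSpace.denseSeq ℝ≥0 i) N

lemma gridHit_mem (f : ℝ≥0 → ℝ) (a : ℝ) (N : ℝ≥0) (G : Finset ℝ≥0) :
    (gridHit f a N G = N ∨ gridHit f a N G ∈ G) ∧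
      (gridHit f a N G = N ∨ a < f (gridHit f a N G)) := by
  classical
  have h := Finset.min'_mem ((insert N G).filter fun s => s = N ∨ a < f s) ⟨N, by simp⟩
  rw [Finset.mem_filter, Finset.mem_insert] at h
  convert h <;> simp [gridHit]

lemma gridHit_le_iff {f : ℝ≥0 → ℝ} {a : ℝ} {N : ℝ≥0} {G : Finset ℝ≥0} {i : ℝ≥0} :
    gridHit f a N G ≤ i ↔ N ≤ i ∨ ∃ s ∈ G, s ≤ i ∧ a < f s := by
  constructor
  · intro h
    rcases gridHit_mem f a N G with ⟨h1 | h1, h2 | h2⟩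
    · left; rwa [← h1]
    · left; rwa [← h1]
    · left; rwa [← h2]
    · exact Or.inr ⟨_, h1, h, h2⟩
  · rintro (h | ⟨s, hs, hsi, has⟩)
    · refine le_trans (Finset.min'_le _ _ ?_) h
      simp
    · refine le_trans (Finset.min'_le _ _ ?_) hsi
      simp [hs, has]

lemma truncHit_le (f : ℝ≥0 → ℝ) (a : ℝ) (N : ℝ≥0) : truncHit f a N ≤ N :=
  csInf_le' ⟨le_rfl, Or.inl rfl⟩

/-- Exceeding `a` is an open condition, so a time of exceedance before `N` can be moved to a nearby
point of the dense sequence. -/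
lemma tendsto_gridHit {f : ℝ≥0 → ℝ} (hf : Continuous f) (a : ℝ) (N : ℝ≥0) :
    Tendsto (fun n => gridHit f a N (denseGrid N n)) atTop (𝓝 (truncHit f a N)) := by
  have hge (n : ℕ) : truncHit f a N ≤ gridHit f a N (denseGrid N n) := by
    refine csInf_le' ⟨?_, (gridHit_mem f a N _).2⟩
    exact gridHit_le_iff.2 (Or.inl le_rfl)
  refine tendsto_order.2 ⟨fun u hu => .of_forall fun n => hu.trans_le (hge n), fun u hu => ?_⟩
  obtain ⟨s, ⟨hsN, hs⟩, hsu⟩ := exists_lt_of_csInf_lt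
    (s := {s | s ≤ N ∧ (s = N ∨ a < f s)}) ⟨N, le_rfl, Or.inl rfl⟩ hu
  rcases hsN.eq_or_lt with rfl | hsN
  · exact .of_forall fun n => (gridHit_le_iff.2 (Or.inl le_rfl)).trans_lt hsu
  have has : a < f s := hs.resolve_left hsN.ne
  have hopen : IsOpen {x | x < u ∧ x < N ∧ a < f x} :=
    (isOpen_Iio (a := u)).inter ((isOpen_Iio (a := N)).inter (isOpen_lt continuous_const hf))
  obtain ⟨m, hmu, hmN, hma⟩ :=
    (TopologicalSpace.denseRange_denseSeq ℝ≥0).exists_mem_open hopen ⟨s, hsu, hsN, has⟩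
  filter_upwards [eventually_gt_atTop m] with n hn
  refine lt_of_le_of_lt (gridHit_le_iff.2 (Or.inr ⟨_, ?_, le_rfl, hma⟩)) hmu
  simp only [denseGrid, Finset.mem_image, Finset.mem_range]
  exact ⟨m, hn, min_eq_left hmN.le⟩

lemma truncHit_of_forall_le {f : ℝ≥0 → ℝ} {a : ℝ} {N : ℝ≥0} (h : ∀ s < N, f s ≤ a) :
    truncHit f a N = N := by
  refine le_antisymm (truncHit_le f a N) (le_csInf ⟨N, le_rfl, Or.inl rfl⟩ ?_)
  rintro s ⟨hsN, rfl | hs⟩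
  · exact le_rfl
  · by_contra! hlt
    exact (h s hlt).not_gt hs

lemma truncHit_of_exists {f : ℝ≥0 → ℝ} {a : ℝ} {N : ℝ≥0} (h : ∃ s < N, a < f s) :
    truncHit f a N = hitTime f a := by
  obtain ⟨s, hsN, hs⟩ := h
  refine le_antisymm (le_csInf (s := {s | a < f s}) ⟨s, hs⟩ fun r hr => ?_)
    (le_csInf (s := {s | s ≤ N ∧ (s = N ∨ a < f s)}) ⟨N, le_rfl, Or.inl rfl⟩ ?_)
  · rcases le_total r N with h | h
    · exact csInf_le' (s := {s | s ≤ N ∧ (s = N ∨ a < f s)}) ⟨h, Or.inr hr⟩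
    · exact (truncHit_le f a N).trans h
  · rintro r ⟨hrN, rfl | hr⟩
    · exact (csInf_le' (s := {s | a < f s}) hs).trans hsN.le
    · exact csInf_le' hr

lemma truncHit_lt_iff {f : ℝ≥0 → ℝ} {a : ℝ} {N : ℝ≥0} :
    truncHit f a N < N ↔ ∃ s < N, a < f s := by
  constructor
  · intro h
    by_contra! h'
    exact h.ne (truncHit_of_forall_le h')
  · rintro ⟨s, hsN, hs⟩
    exact (csInf_le' (s := {s | s ≤ N ∧ (s = N ∨ a < f s)}) ⟨hsN.le, Or.inr hs⟩).trans_lt hsN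

lemma apply_truncHit_le {f : ℝ≥0 → ℝ} (hf : Continuous f) {a : ℝ} (ha : f 0 ≤ a) (N : ℝ≥0) :
    f (truncHit f a N) ≤ a := by
  by_contra! h
  have h0 : 0 < truncHit f a N := by
    rw [pos_iff_ne_zero]
    intro h0
    rw [h0] at h
    exact h.not_ge ha
  have hmem : {x | a < f x} ∈ 𝓝 (truncHit f a N) :=
    (isOpen_lt continuous_const hf).mem_nhds h
  obtain ⟨l, hl, hsub⟩ := exists_Ioc_subset_of_mem_nhds hmem ⟨0, h0⟩
  obtain ⟨s, hls, hsT⟩ := exists_between hl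
  have hs : a < f s := hsub ⟨hls, hsT.le⟩
  exact hsT.not_ge (csInf_le' ⟨hsT.le.trans (truncHit_le f a N), Or.inr hs⟩)

lemma apply_hitTime {f : ℝ≥0 → ℝ} (hf : Continuous f) {a : ℝ} (ha : f 0 ≤ a)
    (h : ∃ s, a < f s) : f (hitTime f a) = a := by
  obtain ⟨s, hs⟩ := h
  refine le_antisymm ?_ ?_
  · rw [← truncHit_of_exists (N := s + 1) ⟨s, by simp, hs⟩]
    exact apply_truncHit_le hf ha _
  · have h1 : hitTime f a ∈ closure {s | a < f s} := csInf_mem_closure ⟨s, hs⟩ (OrderBot.bddBelow _)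
    exact closure_lt_subset_le continuous_const hf h1

section

variable {Ω : Type*} [mΩ : MeasurableSpace Ω] {P : Measure Ω} {W : ℝ≥0 → Ω → ℝ}

namespace IsRegularBrownian

/-- The grid is needed: exceeding `a` immediately after time `i` is not visible in the unaugmented
past of `i`, so `truncHit` is only treated as a limit of these times. -/
lemma isStoppingTime_gridHit (hW : IsRegularBrownian W P) (μ a : ℝ) (N : ℝ≥0) (G : Finset ℝ≥0) :
    IsStoppingTime (pastFiltration hW.measurable)
      (fun ω => (gridHit (fun s => W s ω + μ * s) a N G : WithTop ℝ≥0)) := by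
  intro i
  have : {ω | (gridHit (fun s => W s ω + μ * s) a N G : WithTop ℝ≥0) ≤ (i : WithTop ℝ≥0)} =
      {ω | N ≤ i} ∪ ⋃ s ∈ G.filter (· ≤ i), {ω | a < W s ω + μ * s} := by
    ext ω
    rw [mem_ofPred_eq, WithTop.coe_le_coe, gridHit_le_iff]
    simp [and_assoc]
  rw [this]
  refine MeasurableSet.union (MeasurableSet.const _) (Finset.measurableSet_biUnion _ fun s hs => ?_)
  have hs' := measurable_pastFiltration hW.measurable (Finset.mem_filter.1 hs).2
  exact measurableSet_lt measurable_const (hs'.add_const _)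

lemma continuous_add_mul (hW : IsRegularBrownian W P) (μ : ℝ) (ω : Ω) :
    Continuous fun s : ℝ≥0 => W s ω + μ * s :=
  (hW.continuous ω).add (by fun_prop)

lemma measurable_gridHit (hW : IsRegularBrownian W P) (μ a : ℝ) (N : ℝ≥0) (G : Finset ℝ≥0) :
    Measurable fun ω => gridHit (fun s => W s ω + μ * s) a N G := by
  refine measurable_of_Iic fun i => ?_
  have h := (pastFiltration hW.measurable).le i _ (hW.isStoppingTime_gridHit μ a N G i)
  convert h using 1
  ext ω
  exact (WithTop.coe_le_coe (α := ℝ≥0)).symm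

lemma measurable_truncHit (hW : IsRegularBrownian W P) (μ a : ℝ) (N : ℝ≥0) :
    Measurable fun ω => truncHit (fun s => W s ω + μ * s) a N :=
  measurable_of_tendsto_metrizable (fun n => hW.measurable_gridHit μ a N (denseGrid N n))
    (tendsto_pi_nhds.2 fun ω => tendsto_gridHit (hW.continuous_add_mul μ ω) a N)

lemma expBM_gridHit_ae_eq (hW : IsRegularBrownian W P) (θ μ a : ℝ) (N : ℝ≥0) (n : ℕ) :
    (fun ω => expBM θ W (gridHit (fun s => W s ω + μ * s) a N (denseGrid N n)) ω) =ᵐ[P]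
      P[expBM θ W N | (hW.isStoppingTime_gridHit μ a N (denseGrid N n)).measurableSpace] := by
  have := hW.isProbabilityMeasure
  refine Martingale.stoppedValue_ae_eq_condExp_of_le_const_of_countable_range
    (hW.martingale_expBM θ) (hW.isStoppingTime_gridHit μ a N (denseGrid N n)) (n := N) ?_ ?_
  · intro ω
    exact WithTop.coe_le_coe.2 (gridHit_le_iff.2 (Or.inl le_rfl))
  · refine ((insert N (denseGrid N n)).finite_toSet.image
      ((↑) : ℝ≥0 → WithTop ℝ≥0)).countable.mono ?_
    rintro _ ⟨ω, rfl⟩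
    refine ⟨_, ?_, rfl⟩
    simpa using (gridHit_mem (fun s => W s ω + μ * s) a N (denseGrid N n)).1

/-- Optional stopping for the exponential martingale at a truncated hitting time. -/
lemma integral_expBM_truncHit (hW : IsRegularBrownian W P) (θ μ a : ℝ) (N : ℝ≥0)
    (hint : Integrable (fun ω => expBM θ W (truncHit (fun s => W s ω + μ * s) a N) ω) P) :
    ∫ ω, expBM θ W (truncHit (fun s => W s ω + μ * s) a N) ω ∂P = 1 := by
  have := hW.isProbabilityMeasure
  set Z : ℕ → Ω → ℝ :=
    fun n ω => expBM θ W (gridHit (fun s => W s ω + μ * s) a N (denseGrid N n)) ω with hZ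
  have hle (n : ℕ) := (hW.isStoppingTime_gridHit μ a N (denseGrid N n)).measurableSpace_le
  have hZc (n : ℕ) := hW.expBM_gridHit_ae_eq θ μ a N n
  -- The stopped values are conditional expectations of one integrable variable, hence uniformly
  -- integrable, so their means converge along with them.
  have hui := (integrable_expBM hW.isPreBrownianReal θ N).uniformIntegrable_condExp hle
  have hui' : UnifIntegrable Z 1 P := hui.2.1.ae_eq fun n => (hZc n).symm
  have hZi (n : ℕ) : Integrable (Z n) P := (integrable_condExp).congr (hZc n).symm
  have hZ1 (n : ℕ) : ∫ ω, Z n ω ∂P = 1 := by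
    rw [integral_congr_ae (hZc n), integral_condExp (hle n),
      integral_expBM hW.isPreBrownianReal]
  have hlim := tendsto_Lp_finite_of_tendsto_ae le_rfl ENNReal.one_ne_top
    (fun n => (hZi n).aestronglyMeasurable) (memLp_one_iff_integrable.2 hint) hui' (by
      refine .of_forall fun ω => ?_
      have hc : Continuous fun t : ℝ≥0 => expBM θ W t ω := by
        have := hW.continuous ω
        unfold expBM
        fun_prop
      exact (hc.tendsto _).comp (tendsto_gridHit (hW.continuous_add_mul μ ω) a N))
  have := tendsto_integral_of_L1' _ hint.aestronglyMeasurable (.of_forall hZi) hlim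
  simp_rw [hZ1] at this
  exact (tendsto_nhds_unique this tendsto_const_nhds)

end IsRegularBrownian

end

/-! ### Laplace transform of the hitting time -/

section

variable {Ω : Type*} [mΩ : MeasurableSpace Ω] {P : Measure Ω} {W : ℝ≥0 → Ω → ℝ}

namespace IsRegularBrownian

lemma measurable_expBM_truncHit (hW : IsRegularBrownian W P) (θ μ a : ℝ) (N : ℝ≥0) :
    Measurable fun ω => expBM θ W (truncHit (fun s => W s ω + μ * s) a N) ω := by
  have h : Measurable fun p : ℝ≥0 × Ω => expBM θ W p.1 p.2 := by
    have h1 : Measurable (Function.uncurry fun t ω => expBM θ W t ω) := by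
      refine (stronglyMeasurable_uncurry_of_continuous_of_stronglyMeasurable ?_ ?_).measurable
      · intro ω
        have := hW.continuous ω
        unfold expBM
        fun_prop
      · intro t
        have := hW.measurable t
        unfold expBM
        exact Measurable.stronglyMeasurable (by fun_prop)
    exact h1
  exact h.comp ((hW.measurable_truncHit μ a N).prodMk measurable_id)

/-- The Laplace transform of the hitting time of `a` by the Brownian motion with drift `μ`. -/
lemma integral_exp_hitTime (hW : IsRegularBrownian W P) {θ μ l a : ℝ} (hθ : 0 < θ)
    (hl : l = θ * μ + θ ^ 2 / 2) (hl0 : 0 ≤ l) (ha : 0 ≤ a) :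
    ∫ ω, {ω | ∃ s, a < W s ω + μ * s}.indicator
      (fun ω => Real.exp (-l * hitTime (fun s => W s ω + μ * s) a)) ω ∂P = Real.exp (-θ * a) := by
  have := hW.isProbabilityMeasure
  let Y : Ω → ℝ≥0 → ℝ := fun ω s => W s ω + μ * s
  have hYc (ω : Ω) : Continuous (Y ω) := hW.continuous_add_mul μ ω
  have hY0 (ω : Ω) : Y ω 0 ≤ a := by simpa [Y, hW.zero ω] using ha
  have hZ (t : ℝ≥0) (ω : Ω) : expBM θ W t ω = Real.exp (θ * Y ω t) * Real.exp (-l * t) := by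
    rw [expBM, ← Real.exp_add, hl]
    congr 1
    simp only [Y]
    ring
  let T : ℕ → Ω → ℝ≥0 := fun n ω => truncHit (Y ω) a n
  let F : ℕ → Ω → ℝ := fun n => {ω | T n ω < n}.indicator fun ω => Real.exp (-l * T n ω)
  have hTm (n : ℕ) : Measurable (T n) := hW.measurable_truncHit μ a n
  have hFm (n : ℕ) : Measurable (F n) := by
    refine Measurable.indicator ?_ (measurableSet_lt (hTm n) measurable_const)
    exact Real.measurable_exp.comp ((measurable_coe_nnreal_real.comp (hTm n)).const_mul _)
  have hexp (t : ℝ≥0) : Real.exp (-l * t) ≤ 1 := by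
    rw [Real.exp_le_one_iff]
    have := mul_nonneg hl0 t.2
    simpa using this
  have hF0 (n : ℕ) (ω : Ω) : 0 ≤ F n ω := indicator_nonneg (fun _ _ => (Real.exp_pos _).le) _
  have hF1 (n : ℕ) (ω : Ω) : F n ω ≤ 1 := by
    by_cases h : T n ω < n
    · simpa [F, h] using hexp (T n ω)
    · simp [F, h]
  have hFi (n : ℕ) : Integrable (F n) P :=
    Integrable.of_bound (hFm n).aestronglyMeasurable 1 (.of_forall fun ω => by
      rw [Real.norm_of_nonneg (hF0 n ω)]; exact hF1 n ω)
  let Z : ℕ → Ω → ℝ := fun n ω => expBM θ W (T n ω) ω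
  have hZle (n : ℕ) (ω : Ω) : Z n ω ≤ Real.exp (θ * a) := by
    simp only [Z, hZ]
    calc _ ≤ Real.exp (θ * a) * 1 := by
          refine mul_le_mul ?_ (hexp _) (Real.exp_pos _).le (Real.exp_pos _).le
          exact Real.exp_le_exp.2 (mul_le_mul_of_nonneg_left
            (apply_truncHit_le (hYc ω) (hY0 ω) n) hθ.le)
      _ = _ := mul_one _
  have hZ0 (n : ℕ) (ω : Ω) : 0 ≤ Z n ω := (Real.exp_pos _).le
  have hZi (n : ℕ) : Integrable (Z n) P :=
    Integrable.of_bound (hW.measurable_expBM_truncHit θ μ a n).aestronglyMeasurable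
      (Real.exp (θ * a)) (.of_forall fun ω => by
        rw [Real.norm_of_nonneg (hZ0 n ω)]; exact hZle n ω)
  have hZ1 (n : ℕ) : ∫ ω, Z n ω ∂P = 1 := hW.integral_expBM_truncHit θ μ a n (hZi n)
  -- This bounds the contribution of paths with no exceedance before `n`. There `Y_n ≤ a` absorbs
  -- half of the exponent, and the martingale with parameter `θ / 2` handles the rest. The spare
  -- factor `exp (-θ² n / 8)` makes it vanish even when `l = 0`.
  have hhalf (n : ℕ) : Integrable (fun ω => Real.exp (θ * a / 2) *
      (expBM (θ / 2) W n ω * Real.exp (-(θ ^ 2 / 8) * n))) P :=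
    ((integrable_expBM hW.isPreBrownianReal (θ / 2) n).mul_const _).const_mul _
  have hZF (n : ℕ) (ω : Ω) : Real.exp (θ * a) * F n ω ≤ Z n ω ∧
      Z n ω ≤ Real.exp (θ * a) * F n ω + Real.exp (θ * a / 2) *
        (expBM (θ / 2) W n ω * Real.exp (-(θ ^ 2 / 8) * n)) := by
    have hpos : 0 < Real.exp (θ * a / 2) *
        (expBM (θ / 2) W n ω * Real.exp (-(θ ^ 2 / 8) * n)) := by
      unfold expBM; positivity
    by_cases h : T n ω < n
    · have hex := truncHit_lt_iff.1 h
      have hT : T n ω = hitTime (Y ω) a := truncHit_of_exists hex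
      have hYT : Y ω (T n ω) = a := by
        rw [hT]
        exact apply_hitTime (hYc ω) (hY0 ω) (hex.imp fun _ h => h.2)
      have : Z n ω = Real.exp (θ * a) * F n ω := by
        simp [Z, F, h, hZ, hYT]
      rw [this]
      exact ⟨le_rfl, by linarith⟩
    · have hT : T n ω = n := le_antisymm (truncHit_le _ _ _) (not_lt.1 h)
      have hYn : Y ω n ≤ a := by
        rw [← hT]; exact apply_truncHit_le (hYc ω) (hY0 ω) n
      refine ⟨by simpa [F, h] using hZ0 n ω, ?_⟩
      simp only [F, indicator, mem_ofPred_eq, h, if_false, mul_zero, zero_add]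
      simp only [Z, hT, expBM, ← Real.exp_add]
      refine Real.exp_le_exp.2 ?_
      have h1 : θ * Y ω n / 2 ≤ θ * a / 2 := by gcongr
      have h2 : 0 ≤ l * n := by positivity
      rw [hl] at h2
      simp only [Y, NNReal.coe_natCast] at h1 h2 ⊢
      nlinarith
  have hFlim : Tendsto (fun n => ∫ ω, F n ω ∂P) atTop (𝓝 (Real.exp (-θ * a))) := by
    have hlow (n : ℕ) : Real.exp (θ * a) * ∫ ω, F n ω ∂P ≤ 1 := by
      rw [← hZ1 n, ← integral_const_mul]
      exact integral_mono ((hFi n).const_mul _) (hZi n) fun ω => (hZF n ω).1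
    have hup (n : ℕ) : 1 ≤ Real.exp (θ * a) * ∫ ω, F n ω ∂P +
        Real.exp (θ * a / 2) * Real.exp (-(θ ^ 2 / 8) * n) := by
      calc 1 = ∫ ω, Z n ω ∂P := (hZ1 n).symm
        _ ≤ ∫ ω, (Real.exp (θ * a) * F n ω + Real.exp (θ * a / 2) *
              (expBM (θ / 2) W n ω * Real.exp (-(θ ^ 2 / 8) * n))) ∂P :=
            integral_mono (hZi n) (((hFi n).const_mul _).add (hhalf n)) fun ω => (hZF n ω).2
        _ = _ := by
            rw [integral_add ((hFi n).const_mul _) (hhalf n), integral_const_mul,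
              integral_const_mul, integral_mul_const, integral_expBM hW.isPreBrownianReal, one_mul]
    have hrest : Tendsto (fun n : ℕ => Real.exp (θ * a / 2) * Real.exp (-(θ ^ 2 / 8) * n))
        atTop (𝓝 0) := by
      rw [← mul_zero (Real.exp (θ * a / 2))]
      refine Tendsto.const_mul _ (Real.tendsto_exp_atBot.comp ?_)
      exact tendsto_natCast_atTop_atTop.const_mul_atTop_of_neg (by nlinarith)
    have hprod : Tendsto (fun n => Real.exp (θ * a) * ∫ ω, F n ω ∂P) atTop (𝓝 1) := by
      refine tendsto_of_tendsto_of_tendsto_of_le_of_le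
        (g := fun n : ℕ => 1 - Real.exp (θ * a / 2) * Real.exp (-(θ ^ 2 / 8) * n))
        (by simpa using tendsto_const_nhds.sub hrest) tendsto_const_nhds
        (fun n => ?_) hlow
      have := hup n
      simp only
      linarith
    have := hprod.const_mul (Real.exp (-θ * a))
    simp_rw [← mul_assoc, ← Real.exp_add] at this
    simpa using this
  have hFlim' := tendsto_integral_of_dominated_convergence (μ := P) (F := F)
    (f := {ω | ∃ s, a < W s ω + μ * s}.indicator
      (fun ω => Real.exp (-l * hitTime (fun s => W s ω + μ * s) a))) (fun _ => 1)
    (fun n => (hFm n).aestronglyMeasurable) (integrable_const _)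
    (fun n => .of_forall fun ω => by
      rw [Real.norm_of_nonneg (hF0 n ω)]; exact hF1 n ω)
    (.of_forall fun ω => by
      refine tendsto_const_nhds.congr' ?_
      by_cases h : ∃ s, a < W s ω + μ * s
      · obtain ⟨s, hs⟩ := h
        obtain ⟨m, hm⟩ := exists_nat_gt s
        filter_upwards [eventually_ge_atTop m] with n hn
        have hex : ∃ s < (n : ℝ≥0), a < Y ω s :=
          ⟨s, hm.trans_le (by exact_mod_cast hn), hs⟩
        have hT : T n ω = hitTime (Y ω) a := truncHit_of_exists hex
        rw [indicator_of_mem (show ω ∈ {ω | ∃ s, a < W s ω + μ * s} from ⟨s, hs⟩)]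
        simp only [F]
        rw [indicator_of_mem (show ω ∈ {ω | T n ω < n} from truncHit_lt_iff.2 hex), hT]
      -- If `a` is never exceeded, `hitTime` is the infimum of the empty set, namely `0`; the
      -- indicator discards this value.
      · refine .of_forall fun n => ?_
        rw [indicator_of_notMem (by exact h)]
        simp only [F]
        rw [indicator_of_notMem]
        exact fun h' => h ((truncHit_lt_iff.1 h').imp fun _ h => h.2))
  exact tendsto_nhds_unique hFlim' hFlim

end IsRegularBrownian

end

/-! ### Exponential times -/

lemma expMeasure_Ioi {r b : ℝ} (hr : 0 < r) (hb : 0 ≤ b) :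
    expMeasure r (Ioi b) = ENNReal.ofReal (Real.exp (-r * b)) := by
  have := isProbabilityMeasure_expMeasure hr
  rw [← compl_Iic, prob_compl_eq_one_sub measurableSet_Iic, ← ofReal_cdf, cdf_expMeasure_eq hr,
    if_pos hb, ← ENNReal.ofReal_one, ← ENNReal.ofReal_sub]
  · simp
  · rw [sub_nonneg, Real.exp_le_one_iff]
    have := mul_nonneg hr.le hb
    linarith

lemma expMeasure_singleton (r b : ℝ) : expMeasure r {b} = 0 := by
  have : expMeasure r ≪ volume := withDensity_absolutelyContinuous _ _
  exact this (by simp)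

lemma expMeasure_Ici {r b : ℝ} (hr : 0 < r) (hb : 0 ≤ b) :
    expMeasure r (Ici b) = ENNReal.ofReal (Real.exp (-r * b)) := by
  rw [← expMeasure_Ioi hr hb, ← Ioi_union_left]
  refine le_antisymm ((measure_union_le _ _).trans ?_) (measure_mono subset_union_left)
  rw [expMeasure_singleton, add_zero]

lemma ae_nonneg_expMeasure {r : ℝ} (hr : 0 < r) : ∀ᵐ a ∂expMeasure r, 0 ≤ a := by
  have := isProbabilityMeasure_expMeasure hr
  have h : Ici (0 : ℝ) ∈ ae (expMeasure r) := by
    rw [mem_ae_iff_prob_eq_one measurableSet_Ici, expMeasure_Ici hr le_rfl]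
    simp
  exact h

lemma lintegral_exp_expMeasure {r θ : ℝ} (hr : 0 < r) (hθ : 0 ≤ θ) :
    ∫⁻ a, ENNReal.ofReal (Real.exp (-θ * a)) ∂expMeasure r = ENNReal.ofReal (r / (r + θ)) := by
  have hm : Measurable (exponentialPDF r) := (measurable_exponentialPDFReal r).ennreal_ofReal
  have hm' : Measurable (exponentialPDF (r + θ)) :=
    (measurable_exponentialPDFReal (r + θ)).ennreal_ofReal
  have h : expMeasure r = volume.withDensity (exponentialPDF r) := rfl
  rw [h, lintegral_withDensity_eq_lintegral_mul _ hm (by fun_prop)]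
  have h2 : ∀ a, (exponentialPDF r * fun a => ENNReal.ofReal (Real.exp (-θ * a))) a =
      ENNReal.ofReal (r / (r + θ)) * exponentialPDF (r + θ) a := by
    intro a
    simp only [Pi.mul_apply, exponentialPDF_eq]
    rw [← ENNReal.ofReal_mul' (Real.exp_pos _).le, ← ENNReal.ofReal_mul (by positivity)]
    congr 1
    split_ifs
    · rw [mul_assoc, ← Real.exp_add]
      field_simp
      congr 2
      ring
    · simp
  simp_rw [h2]
  rw [lintegral_const_mul _ hm', lintegral_exponentialPDF_eq_one (by positivity), mul_one]

lemma exists_lt_iff_denseSeq {f : ℝ≥0 → ℝ} (hf : Continuous f) (a : ℝ) :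
    (∃ s, a < f s) ↔ ∃ n, a < f (TopologicalSpace.denseSeq ℝ≥0 n) := by
  refine ⟨fun ⟨s, hs⟩ => ?_, fun ⟨n, hn⟩ => ⟨_, hn⟩⟩
  exact (TopologicalSpace.denseRange_denseSeq ℝ≥0).exists_mem_open
    (isOpen_lt continuous_const hf) ⟨s, hs⟩

lemma exists_le_lt_iff_denseSeq {f : ℝ≥0 → ℝ} (hf : Continuous f) (a : ℝ) (t : ℝ≥0) :
    (∃ s ≤ t, a < f s) ↔ ∃ n, a < f (min (TopologicalSpace.denseSeq ℝ≥0 n) t) := by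
  rw [← exists_lt_iff_denseSeq (f := fun s => f (min s t)) (by fun_prop)]
  exact ⟨fun ⟨s, hst, hs⟩ => ⟨s, by simpa [hst] using hs⟩, fun ⟨s, hs⟩ => ⟨_, min_le_right _ _, hs⟩⟩

/-- The probability that an exponential time comes after the path `f` has exceeded `a`. -/
lemma expMeasure_exists_le {l : ℝ} (hl : 0 < l) (f : ℝ≥0 → ℝ) (a : ℝ) (h : ∃ s, a < f s) :
    expMeasure l {t | ∃ s : ℝ≥0, (s : ℝ) ≤ t ∧ a < f s} =
      ENNReal.ofReal (Real.exp (-l * hitTime f a)) := by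
  -- The event lies between the open and the closed half-line starting at the hitting time; these
  -- have equal mass, since an exponential law has no atoms.
  refine le_antisymm ?_ ?_
  · rw [← expMeasure_Ici hl (hitTime f a).coe_nonneg]
    refine measure_mono fun t ⟨s, hst, hs⟩ => le_trans ?_ hst
    exact NNReal.coe_le_coe.2 (csInf_le' (s := {s | a < f s}) hs)
  · rw [← expMeasure_Ioi hl (hitTime f a).coe_nonneg]
    refine measure_mono fun t ht => ?_
    have ht' : hitTime f a < t.toNNReal := Real.lt_toNNReal_iff_coe_lt.2 ht
    obtain ⟨s, hs, hst⟩ := exists_lt_of_csInf_lt (s := {s | a < f s}) h ht'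
    exact ⟨s, (Real.lt_toNNReal_iff_coe_lt.1 hst).le, hs⟩

section

variable {Ω : Type*} [mΩ : MeasurableSpace Ω] {P : Measure Ω} {W : ℝ≥0 → Ω → ℝ}

namespace IsRegularBrownian

lemma measurableSet_exists_lt (hW : IsRegularBrownian W P) (μ a : ℝ) :
    MeasurableSet {ω | ∃ s, a < W s ω + μ * s} := by
  simp_rw [exists_lt_iff_denseSeq (hW.continuous_add_mul μ _) a]
  simp only [ofPred_exists]
  exact .iUnion fun n => measurableSet_lt measurable_const ((hW.measurable _).add_const _)

/-- The tail of the global maximum of a Brownian motion with negative drift. -/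
lemma measure_exists_lt (hW : IsRegularBrownian W P) {σ a : ℝ} (hσ : 0 < σ) (ha : 0 ≤ a) :
    P {ω | ∃ s, a < W s ω + -σ * s} = ENNReal.ofReal (Real.exp (-(2 * σ) * a)) := by
  have := hW.isProbabilityMeasure
  -- With drift `-σ`, the choice `θ = 2σ` gives `l = 0`, so only the probability of exceeding `a`
  -- remains.
  have h := hW.integral_exp_hitTime (θ := 2 * σ) (μ := -σ) (l := 0) (by positivity) (by ring)
    le_rfl ha
  simp only [neg_zero, zero_mul, Real.exp_zero] at h
  rw [integral_indicator (hW.measurableSet_exists_lt (-σ) a)] at h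
  simp only [integral_const, smul_eq_mul, mul_one, measureReal_restrict_apply_univ] at h
  rw [← h, measureReal_def, ENNReal.ofReal_toReal (measure_ne_top _ _)]

lemma lintegral_expMeasure_exists_le (hW : IsRegularBrownian W P) {θ μ l a : ℝ} (hθ : 0 < θ)
    (hl : l = θ * μ + θ ^ 2 / 2) (hl0 : 0 < l) (ha : 0 ≤ a) :
    ∫⁻ ω, expMeasure l {t | ∃ s : ℝ≥0, (s : ℝ) ≤ t ∧ a < W s ω + μ * s} ∂P =
      ENNReal.ofReal (Real.exp (-θ * a)) := by
  have h := hW.integral_exp_hitTime hθ hl hl0.le ha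
  rw [← h, ofReal_integral_eq_lintegral_ofReal]
  · refine lintegral_congr fun ω => ?_
    by_cases hω : ∃ s, a < W s ω + μ * s
    · rw [indicator_of_mem (by exact hω), expMeasure_exists_le hl0 (fun s => W s ω + μ * s) a hω]
    · rw [indicator_of_notMem (by exact hω)]
      push Not at hω
      simp [(hω _).not_gt]
  -- A non-integrable function would have integral `0`, but the integral is known to be positive.
  · by_contra h'
    rw [integral_undef h'] at h
    exact (Real.exp_pos _).ne h
  · exact .of_forall fun ω => indicator_nonneg (fun _ _ => (Real.exp_pos _).le) _

end IsRegularBrownian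
end

/-! ### The last maximizer of a deterministic path -/

section paths

variable {f : ℝ≥0 → ℝ}

lemma exists_ge_forall_le (hf : Continuous f) (hlim : Tendsto f atTop atBot) (t : ℝ≥0) :
    ∃ u ≥ t, ∀ s ≥ t, f s ≤ f u := by
  obtain ⟨u, hu, hmax⟩ := hf.continuousOn.exists_isMaxOn' (s := Ici t) isClosed_Ici
    (x₀ := t) self_mem_Ici (by
      rw [cocompact_eq_atTop]
      exact (hlim.eventually_le_atBot (f t)).filter_mono inf_le_left)
  exact ⟨u, hu, fun s hs => hmax hs⟩

/-- The set of points at which `f` attains its maximum. -/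
def argmaxSet (f : ℝ≥0 → ℝ) : Set ℝ≥0 := {t | ∀ s, f s ≤ f t}

lemma argmaxSet_nonempty (hf : Continuous f) (hlim : Tendsto f atTop atBot) :
    (argmaxSet f).Nonempty := by
  obtain ⟨u, -, hu⟩ := exists_ge_forall_le hf hlim 0
  exact ⟨u, fun s => hu s (zero_le)⟩

lemma argmaxSet_bddAbove (hlim : Tendsto f atTop atBot) : BddAbove (argmaxSet f) := by
  obtain ⟨b, hb⟩ := eventually_atTop.1 (hlim.eventually_lt_atBot (f 0))
  refine ⟨b, fun t ht => ?_⟩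
  by_contra! h
  exact (hb t h.le).not_ge (ht 0)

lemma sSup_argmaxSet_mem (hf : Continuous f) (hlim : Tendsto f atTop atBot) :
    sSup (argmaxSet f) ∈ argmaxSet f := by
  refine IsClosed.csSup_mem ?_ (argmaxSet_nonempty hf hlim) (argmaxSet_bddAbove hlim)
  simp only [argmaxSet, ofPred_forall]
  exact isClosed_iInter fun s => isClosed_le continuous_const hf

lemma sSup_argmaxSet_lt_iff (hf : Continuous f) (hlim : Tendsto f atTop atBot) (t : ℝ≥0) :
    sSup (argmaxSet f) < t ↔ ∃ s ≤ t, ∀ r, f (t + r) < f s := by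
  have hmem := sSup_argmaxSet_mem hf hlim
  constructor
  · intro h
    refine ⟨_, h.le, fun r => ?_⟩
    by_contra! h'
    have : t + r ∈ argmaxSet f := fun s => (hmem s).trans h'
    exact (h.trans_le le_self_add).not_ge (le_csSup (argmaxSet_bddAbove hlim) this)
  · rintro ⟨s, hs, h⟩
    by_contra! h'
    obtain ⟨r, hr⟩ := exists_add_of_le h'
    have := h r
    rw [← hr] at this
    exact this.not_ge (hmem s)

/-- The supremum of `f` along a dense sequence of times. -/
noncomputable def futureSup (f : ℝ≥0 → ℝ) : ℝ := ⨆ n, f (TopologicalSpace.denseSeq ℝ≥0 n)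

lemma bddAbove_range_of_tendsto (hf : Continuous f) (hlim : Tendsto f atTop atBot) :
    BddAbove (range f) := by
  obtain ⟨u, -, hu⟩ := exists_ge_forall_le hf hlim 0
  exact ⟨f u, by rintro _ ⟨s, rfl⟩; exact hu s (zero_le)⟩

lemma lt_futureSup_iff (hf : Continuous f) (hb : BddAbove (range f)) {a : ℝ} :
    a < futureSup f ↔ ∃ s, a < f s := by
  rw [exists_lt_iff_denseSeq hf, futureSup, lt_ciSup_iff]
  exact hb.mono (by rintro _ ⟨n, rfl⟩; exact ⟨_, rfl⟩)

/-- The supremum of `f` over `[0, t]`, along a dense sequence of times. -/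
noncomputable def pastSup (t : ℝ≥0) (f : Iic t → ℝ) : ℝ :=
  ⨆ n, f ⟨min (TopologicalSpace.denseSeq ℝ≥0 n) t, mem_Iic.2 (min_le_right _ _)⟩

lemma lt_pastSup_iff (hf : Continuous f) {a : ℝ} (t : ℝ≥0) :
    a < pastSup t (fun s => f s) ↔ ∃ s ≤ t, a < f s := by
  rw [exists_le_lt_iff_denseSeq hf, pastSup, lt_ciSup_iff]
  refine (isCompact_Icc.bddAbove_image (K := Icc 0 t) hf.continuousOn).mono ?_
  rintro _ ⟨n, rfl⟩
  exact ⟨_, ⟨zero_le, min_le_right _ _⟩, rfl⟩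

/-- Measuring both suprema relative to `f t` makes one a function of the increments after `t` and
the other a function of the path up to `t`; for Brownian motion these are independent. -/
lemma sSup_argmaxSet_lt_iff_futureSup_lt (hf : Continuous f) (hlim : Tendsto f atTop atBot)
    (t : ℝ≥0) : sSup (argmaxSet f) < t ↔
      futureSup (fun r => f (t + r) - f t) < pastSup t (fun s => f s - f t) := by
  have hg : Continuous fun r => f (t + r) - f t := by fun_prop
  have hglim : Tendsto (fun r => f (t + r) - f t) atTop atBot :=
    tendsto_atBot_add_const_right _ _ (hlim.comp
      (tendsto_atTop_mono (fun _ => le_add_self) tendsto_id))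
  have hgb := bddAbove_range_of_tendsto hg hglim
  rw [sSup_argmaxSet_lt_iff hf hlim]
  rw [lt_pastSup_iff (f := fun s => f s - f t) (by fun_prop)]
  refine exists_congr fun s => and_congr_right fun hs => ⟨fun h => ?_, fun h r => ?_⟩
  -- The future maximum is attained, so the pointwise strict inequality survives passing to the
  -- supremum.
  · obtain ⟨u, hut, hu⟩ := exists_ge_forall_le hf hlim t
    obtain ⟨r, rfl⟩ := exists_add_of_le hut
    refine lt_of_le_of_lt ?_ (sub_lt_sub_right (h r) (f t))
    by_contra! h'
    obtain ⟨q, hq⟩ := (lt_futureSup_iff hg hgb).1 h'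
    have := hu (t + q) le_self_add
    linarith
  · have : f (t + r) - f t ≤ futureSup (fun r => f (t + r) - f t) := by
      by_contra! h'
      exact lt_irrefl _ ((lt_futureSup_iff hg hgb).2 ⟨r, h'⟩)
    linarith

end paths

lemma maxTimes_geomBM {Ω : Type*} {σ : ℝ} (hσ : 0 < σ) (W : ℝ≥0 → Ω → ℝ) (ω : Ω) :
    maxTimes (geomBM σ W) ω = argmaxSet fun s => W s ω + -σ * s := by
  ext t
  have h (s : ℝ≥0) : geomBM σ W s ω ≤ geomBM σ W t ω ↔
      W s ω + -σ * s ≤ W t ω + -σ * t := by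
    have h' (r : ℝ≥0) : 2 * σ * W r ω - 2 * σ ^ 2 * r = 2 * σ * (W r ω + -σ * r) := by ring
    rw [geomBM, geomBM, Real.exp_le_exp, h', h', mul_le_mul_iff_right₀ (by positivity)]
  simp only [argmaxSet, mem_ofPred_eq, ← h]
  exact ⟨fun ht s => ht.1 ⟨s, rfl⟩, fun ht =>
    ⟨by rintro _ ⟨s, rfl⟩; exact ht s, fun b hb => hb ⟨t, rfl⟩⟩⟩

/-! ### Time reversal and the law of the global maximum -/

section

variable {Ω : Type*} [mΩ : MeasurableSpace Ω] {P : Measure Ω} {W : ℝ≥0 → Ω → ℝ}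

namespace IsRegularBrownian

lemma shift (hW : IsRegularBrownian W P) (t : ℝ≥0) :
    IsRegularBrownian (fun s ω => W (t + s) ω - W t ω) P where
  isPreBrownianReal := hW.isPreBrownianReal.shift t
  measurable s := (hW.measurable _).sub (hW.measurable _)
  continuous ω := by
    have := hW.continuous ω
    fun_prop
  zero ω := by simp

/-- Time reversal at `t`. -/
lemma reverse (hW : IsRegularBrownian W P) (t : ℝ≥0) :
    IsRegularBrownian (fun s ω => W (t - s) ω - W (max s t) ω) P where
  isPreBrownianReal := by
    have := hW.isProbabilityMeasure
    have hB := hW.isPreBrownianReal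
    have h2 (s : ℝ≥0) : MemLp (W s) 2 P := (hB.isGaussianProcess.hasGaussianLaw_eval s).memLp_two
    -- After `t` the process continues as `W 0 - W s`, so it is Brownian on the whole half-line. For
    -- `s ≤ r` the four covariances add up to `max s t - (t - s) = s`, with truncated subtraction.
    refine IsGaussianProcess.isPreBrownianReal_of_covariance ?_ (fun s => ?_) fun s r hsr => ?_
    · refine hB.isGaussianProcess.of_isGaussianProcess fun s =>
        ⟨{t - s, max s t},
          { toFun x := x ⟨t - s, by simp⟩ - x ⟨max s t, by simp⟩
            map_add' x y := by simp; abel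
            map_smul' c x := by simp; ring }, by simp⟩
    · rw [integral_sub (hB.integrable_eval _) (hB.integrable_eval _), hB.integral_eval,
        hB.integral_eval, sub_zero]
    · rw [covariance_fun_sub_fun_sub (h2 _) (h2 _) (h2 _) (h2 _),
        hB.covariance_eval, hB.covariance_eval, hB.covariance_eval, hB.covariance_eval,
        min_eq_right (tsub_le_tsub_left hsr t),
        min_eq_left (tsub_le_self.trans (le_max_right r t)),
        min_eq_right (tsub_le_self.trans (le_max_right s t)),
        min_eq_left (max_le_max_right t hsr)]
      rcases le_total s t with h | h
      · rw [max_eq_right h, NNReal.coe_sub h]; ring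
      · rw [max_eq_left h, tsub_eq_zero_of_le h]; simp
  measurable s := (hW.measurable _).sub (hW.measurable _)
  continuous ω := by
    have := hW.continuous ω
    fun_prop
  zero ω := by simp

lemma map_eq {V : ℝ≥0 → Ω → ℝ} (hW : IsRegularBrownian W P) (hV : IsRegularBrownian V P) :
    P.map (fun ω t => W t ω) = P.map (fun ω t => V t ω) := by
  have := hW.isProbabilityMeasure
  refine (map_eq_iff_forall_finset_map_restrict_eq
    (measurable_pi_lambda _ hW.measurable).aemeasurable
    (measurable_pi_lambda _ hV.measurable).aemeasurable).2 fun I => ?_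
  rw [(hW.isPreBrownianReal.hasLaw I).map_eq, (hV.isPreBrownianReal.hasLaw I).map_eq]

lemma measure_exists_le_lt_eq {V : ℝ≥0 → Ω → ℝ} (hW : IsRegularBrownian W P)
    (hV : IsRegularBrownian V P) (μ a : ℝ) (t : ℝ≥0) :
    P {ω | ∃ s ≤ t, a < W s ω + μ * s} = P {ω | ∃ s ≤ t, a < V s ω + μ * s} := by
  let A : Set (ℝ≥0 → ℝ) := ⋃ n : ℕ, {x |
    a < x (min (TopologicalSpace.denseSeq ℝ≥0 n) t) +
      μ * (min (TopologicalSpace.denseSeq ℝ≥0 n) t : ℝ≥0)}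
  have hA : MeasurableSet A := .iUnion fun n =>
    measurableSet_lt measurable_const ((measurable_pi_apply _).add_const _)
  have key {U : ℝ≥0 → Ω → ℝ} (hU : IsRegularBrownian U P) :
      P {ω | ∃ s ≤ t, a < U s ω + μ * s} = P.map (fun ω t => U t ω) A := by
    rw [Measure.map_apply (measurable_pi_lambda _ hU.measurable) hA]
    congr 1
    ext ω
    have := exists_le_lt_iff_denseSeq (hU.continuous_add_mul μ ω) a t
    simpa [A] using this
  rw [key hW, key hV, hW.map_eq hV]

lemma measure_exists_le_reverse (hW : IsRegularBrownian W P) (σ a : ℝ) (t : ℝ≥0) :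
    P {ω | ∃ s ≤ t, a < (W s ω + -σ * s) - (W t ω + -σ * t)} =
      P {ω | ∃ s ≤ t, a < W s ω + σ * s} := by
  rw [hW.measure_exists_le_lt_eq (hW.reverse t)]
  congr 1
  ext ω
  simp only [mem_ofPred_eq]
  constructor
  · rintro ⟨s, hs, h⟩
    refine ⟨t - s, tsub_le_self, ?_⟩
    rw [tsub_tsub_cancel_of_le hs, max_eq_right tsub_le_self, NNReal.coe_sub hs]
    linarith
  · rintro ⟨s, hs, h⟩
    refine ⟨t - s, tsub_le_self, ?_⟩
    rw [max_eq_right hs] at h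
    rw [NNReal.coe_sub hs]
    linarith

/-- Half of the drift already keeps the path almost surely bounded above, by the exponential tail of
its maximum; the other half sends it to `-∞`. -/
lemma ae_tendsto_atBot (hW : IsRegularBrownian W P) {σ : ℝ} (hσ : 0 < σ) :
    ∀ᵐ ω ∂P, Tendsto (fun s : ℝ≥0 => W s ω + -σ * s) atTop atBot := by
  have hb : ∀ᵐ ω ∂P, ∃ n : ℕ, ∀ s, W s ω + -(σ / 2) * s ≤ n := by
    rw [ae_iff]
    refine le_antisymm ?_ (zero_le)
    have hlim : Tendsto (fun n : ℕ => ENNReal.ofReal (Real.exp (-(2 * (σ / 2)) * n)))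
        atTop (𝓝 0) := by
      rw [← ENNReal.ofReal_zero]
      refine ENNReal.tendsto_ofReal (Real.tendsto_exp_atBot.comp ?_)
      exact tendsto_natCast_atTop_atTop.const_mul_atTop_of_neg (by linarith)
    refine ge_of_tendsto' hlim fun n => ?_
    rw [← hW.measure_exists_lt (half_pos hσ) n.cast_nonneg]
    refine measure_mono fun ω hω => ?_
    simp only [mem_ofPred_eq, not_exists, not_forall, not_le] at hω
    exact hω n
  filter_upwards [hb] with ω ⟨n, hn⟩
  have hle (s : ℝ≥0) : W s ω + -σ * s ≤ n + -(σ / 2) * s := by linarith [hn s]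
  refine tendsto_atBot_mono hle ?_
  refine tendsto_atBot_add_const_left _ _ ?_
  exact (NNReal.tendsto_coe_atTop.2 tendsto_id).const_mul_atTop_of_neg (by linarith)

lemma measurable_futureSup (hW : IsRegularBrownian W P) (μ : ℝ) :
    Measurable fun ω => futureSup fun s => W s ω + μ * s :=
  .iSup fun _ => (hW.measurable _).add_const _

/-- The global maximum of a Brownian motion with drift `-σ` is exponential of rate `2 σ`. -/
lemma map_futureSup (hW : IsRegularBrownian W P) {σ : ℝ} (hσ : 0 < σ) :
    P.map (fun ω => futureSup fun s => W s ω + -σ * s) = expMeasure (2 * σ) := by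
  have := hW.isProbabilityMeasure
  have h2 : 0 < 2 * σ := by positivity
  have := isProbabilityMeasure_expMeasure h2
  have hm := hW.measurable_futureSup (-σ)
  have := Measure.isProbabilityMeasure_map (μ := P) hm.aemeasurable
  have hIoi {a : ℝ} (ha : 0 ≤ a) : P.map (fun ω => futureSup fun s => W s ω + -σ * s) (Ioi a) =
      expMeasure (2 * σ) (Ioi a) := by
    rw [Measure.map_apply hm measurableSet_Ioi, expMeasure_Ioi h2 ha, ← hW.measure_exists_lt hσ ha]
    refine measure_congr ?_
    filter_upwards [hW.ae_tendsto_atBot hσ] with ω hω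
    have hc := hW.continuous_add_mul (-σ) ω
    exact propext (lt_futureSup_iff hc (bddAbove_range_of_tendsto hc hω))
  have hIic {a : ℝ} (ha : 0 ≤ a) : P.map (fun ω => futureSup fun s => W s ω + -σ * s) (Iic a) =
      expMeasure (2 * σ) (Iic a) := by
    rw [← compl_Ioi, prob_compl_eq_one_sub measurableSet_Ioi,
      prob_compl_eq_one_sub measurableSet_Ioi, hIoi ha]
  have h0 : expMeasure (2 * σ) (Iic 0) = 0 := by
    rw [← compl_Ioi, prob_compl_eq_one_sub measurableSet_Ioi, expMeasure_Ioi h2 le_rfl]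
    simp
  refine Measure.ext_of_Iic _ _ fun a => ?_
  rcases le_total 0 a with ha | ha
  · exact hIic ha
  · rw [measure_mono_null (Iic_subset_Iic.2 ha) h0,
      measure_mono_null (Iic_subset_Iic.2 ha) ((hIic le_rfl).trans h0)]

end IsRegularBrownian
end

/-! ### Passing to a regular version -/

/-- A Brownian motion is indistinguishable from a regular one. -/
lemma ProbabilityTheory.IsBrownianReal.exists_isRegularBrownian {Ω : Type*} [MeasurableSpace Ω]
    {P : Measure Ω} {W : ℝ≥0 → Ω → ℝ} (hW : IsBrownianReal W P) :
    ∃ V : ℝ≥0 → Ω → ℝ, IsRegularBrownian V P ∧ ∀ᵐ ω ∂P, ∀ t, W t ω = V t ω := by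
  let d := TopologicalSpace.denseSeq ℝ≥0
  let w : ℕ → Ω → ℝ := fun n => (hW.aemeasurable (d n)).mk
  let E : Set Ω := {ω | Continuous (W · ω) ∧ W 0 ω = 0 ∧ ∀ n, W (d n) ω = w n ω}
  have hE : E ∈ ae P := by
    filter_upwards [hW.cont, hW.eval_zero_ae_eq_zero,
      ae_all_iff.2 fun n => (hW.aemeasurable (d n)).ae_eq_mk] with ω h1 h2 h3
    exact ⟨h1, h2, h3⟩
  -- `E` need not be measurable; `G` is a measurable subset of it of full measure, off which the
  -- path is replaced by `0`.
  let G : Set Ω := (toMeasurable P Eᶜ)ᶜ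
  have hGm : MeasurableSet G := (measurableSet_toMeasurable _ _).compl
  have hGE {ω : Ω} (h : ω ∈ G) : ω ∈ E := by
    by_contra h'
    exact h (subset_toMeasurable P Eᶜ h')
  have hG : ∀ᵐ ω ∂P, ω ∈ G := by
    change G ∈ ae P
    rw [mem_ae_iff, compl_compl, measure_toMeasurable]
    exact mem_ae_iff.1 hE
  have heq : ∀ᵐ ω ∂P, ∀ t, W t ω = G.indicator (W t) ω := by
    filter_upwards [hG] with ω hω t
    rw [indicator_of_mem hω]
  refine ⟨fun t => G.indicator (W t), ⟨?_, fun t => ?_, fun ω => ?_, fun ω => ?_⟩, heq⟩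
  · exact hW.toIsPreBrownianReal.congr fun t => heq.mono fun ω h => h t
  -- On `G` the dense coordinates agree with measurable versions; path continuity makes every other
  -- coordinate a limit of these.
  · obtain ⟨u, hu, hlim⟩ := mem_closure_iff_seq_limit.1
      ((TopologicalSpace.denseRange_denseSeq ℝ≥0) t)
    choose k hk using hu
    refine measurable_of_tendsto_metrizable (f := fun n => G.indicator (w (k n)))
      (fun n => ((hW.aemeasurable (d (k n))).measurable_mk).indicator hGm)
      (tendsto_pi_nhds.2 fun ω => ?_)
    by_cases hω : ω ∈ G
    · simp only [indicator_of_mem hω]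
      refine (((hGE hω).1.tendsto t).comp hlim).congr fun n => ?_
      rw [Function.comp_apply, ← hk n]
      exact (hGE hω).2.2 _
    · simp [hω]
  · by_cases hω : ω ∈ G
    · simpa only [indicator_of_mem hω] using (hGE hω).1
    · simpa only [indicator_of_notMem hω] using continuous_const
  · by_cases hω : ω ∈ G
    · simpa only [indicator_of_mem hω] using (hGE hω).2.1
    · simp [hω]

/-! ### Uniqueness for Laplace transforms -/

/-- The function `x ↦ exp (-l x)` on `[0, ∞)`. -/
noncomputable def expNegBCF (l : ℝ≥0) : ℝ≥0 →ᵇ ℝ :=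
  BoundedContinuousFunction.ofNormedAddCommGroup (fun x : ℝ≥0 => Real.exp (-l * x))
    (by fun_prop) 1 fun x => by
      rw [Real.norm_of_nonneg (Real.exp_pos _).le, Real.exp_le_one_iff]
      have := mul_nonneg l.coe_nonneg x.coe_nonneg
      linarith

/-- The submonoid of bounded continuous functions `x ↦ exp (-l x)`, `l ≥ 0`. -/
noncomputable def expNegSubmonoid : Submonoid (ℝ≥0 →ᵇ ℝ) where
  carrier := range expNegBCF
  mul_mem' := by
    rintro _ _ ⟨l, rfl⟩ ⟨m, rfl⟩
    refine ⟨l + m, ?_⟩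
    ext x
    simp only [expNegBCF, BoundedContinuousFunction.coe_ofNormedAddCommGroup,
      BoundedContinuousFunction.coe_mul, Pi.mul_apply, ← Real.exp_add]
    congr 1
    push_cast
    ring
  one_mem' := ⟨0, by ext x; simp [expNegBCF]⟩

/-- The star subalgebra generated by the functions `x ↦ exp (-l x)`, `l ≥ 0`. -/
noncomputable def expNegAlgebra : StarSubalgebra ℝ (ℝ≥0 →ᵇ ℝ) where
  toSubalgebra := Algebra.adjoin ℝ (expNegSubmonoid : Set (ℝ≥0 →ᵇ ℝ))
  star_mem' {f} hf := by
    have : star f = f := by ext x; simp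
    rwa [this]

/-- A finite measure on `[0, ∞)` is determined by its Laplace transform. -/
lemma MeasureTheory.Measure.ext_of_laplace {μ ν : Measure ℝ≥0} [IsFiniteMeasure μ]
    [IsFiniteMeasure ν] (h : ∀ l : ℝ, 0 ≤ l →
      ∫ x : ℝ≥0, Real.exp (-l * x) ∂μ = ∫ x : ℝ≥0, Real.exp (-l * x) ∂ν) : μ = ν := by
  refine ext_of_forall_mem_subalgebra_integral_eq_of_pseudoEMetric_complete_countable
    (𝕜 := ℝ) (A := expNegAlgebra) ?_ ?_
  · intro x y hxy
    refine ⟨expNegBCF 1, ⟨BoundedContinuousFunction.toContinuousMapStarₐ ℝ (expNegBCF 1), ?_, rfl⟩,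
      ?_⟩
    · exact ⟨expNegBCF 1, Algebra.subset_adjoin ⟨1, rfl⟩, rfl⟩
    · simpa [expNegBCF] using hxy
  · intro g hg
    -- The exponentials are closed under products, so the algebra they generate is just their linear
    -- span, and integrals agree by linearity.
    have hg' : g ∈ Submodule.span ℝ (expNegSubmonoid : Set (ℝ≥0 →ᵇ ℝ)) := by
      have h1 : g ∈ Subalgebra.toSubmodule
        (Algebra.adjoin ℝ (expNegSubmonoid : Set (ℝ≥0 →ᵇ ℝ))) := hg
      rwa [Algebra.adjoin_eq_span, Submonoid.closure_eq] at h1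
    clear hg
    induction hg' using Submodule.span_induction with
    | mem x hx =>
      obtain ⟨l, rfl⟩ := hx
      exact h l l.coe_nonneg
    | zero => simp
    | add x y _ _ hx hy =>
      simp only [BoundedContinuousFunction.coe_add, Pi.add_apply]
      rw [integral_add (x.integrable _) (y.integrable _),
        integral_add (x.integrable _) (y.integrable _), hx, hy]
    | smul c x _ hx =>
      simp only [BoundedContinuousFunction.coe_smul, smul_eq_mul]
      rw [integral_const_mul, integral_const_mul, hx]

/-! ### The law of the time of the maximum -/

section

variable {Ω : Type*} [mΩ : MeasurableSpace Ω] {P : Measure Ω} {W : ℝ≥0 → Ω → ℝ}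

namespace IsRegularBrownian

/-- The law of the last time of the maximum, in terms of the maxima of the time-reversed path. -/
lemma measure_sSup_argmaxSet_lt (hW : IsRegularBrownian W P) {σ : ℝ} (hσ : 0 < σ) (t : ℝ≥0) :
    NullMeasurableSet {ω | sSup (argmaxSet fun s => W s ω + -σ * s) < t} P ∧
    P {ω | sSup (argmaxSet fun s => W s ω + -σ * s) < t} =
      ∫⁻ a, P {ω | ∃ s ≤ t, a < W s ω + σ * s} ∂expMeasure (2 * σ) := by
  have := hW.isProbabilityMeasure
  let φ : (ℝ≥0 → ℝ) → ℝ := fun x => futureSup fun r => x r + -σ * r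
  let ψ : (Iic t → ℝ) → ℝ := fun x =>
    pastSup t fun s => (x s + -σ * (s : ℝ≥0)) - (x ⟨t, self_mem_Iic⟩ + -σ * t)
  have hφ : Measurable φ := .iSup fun n => by fun_prop
  have hψ : Measurable ψ := .iSup fun n => by fun_prop
  let M : Ω → ℝ := fun ω => φ fun r => W (t + r) ω - W t ω
  let D : Ω → ℝ := fun ω => ψ fun s => W s ω
  have hM : Measurable M :=
    hφ.comp (measurable_pi_lambda _ fun r => (hW.measurable _).sub (hW.measurable _))
  have hD : Measurable D := hψ.comp (measurable_pi_lambda _ fun r => hW.measurable _)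
  have hind : IndepFun M D P := (hW.isPreBrownianReal.indepFun_shift t).comp hφ hψ
  have hlaw : P.map M = expMeasure (2 * σ) := (hW.shift t).map_futureSup hσ
  have hDlt (ω : Ω) (a : ℝ) :
      a < D ω ↔ ∃ s ≤ t, a < (W s ω + -σ * s) - (W t ω + -σ * t) := by
    have hc := hW.continuous_add_mul (-σ) ω
    exact lt_pastSup_iff (f := fun s => (W s ω + -σ * s) - (W t ω + -σ * t)) (by fun_prop) t
  have hset : {ω | sSup (argmaxSet fun s => W s ω + -σ * s) < t} =ᵐ[P] {ω | M ω < D ω} := by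
    filter_upwards [hW.ae_tendsto_atBot hσ] with ω hω
    have hc := hW.continuous_add_mul (-σ) ω
    have h := sSup_argmaxSet_lt_iff_futureSup_lt hc hω t
    refine propext (h.trans ?_)
    have h1 : (fun r : ℝ≥0 => W (t + r) ω + -σ * (t + r : ℝ≥0) - (W t ω + -σ * t)) =
        fun r => (W (t + r) ω - W t ω) + -σ * r := by
      ext r
      push_cast
      ring
    rw [h1]
    exact Iff.rfl
  have hmeas : MeasurableSet {ω | M ω < D ω} := measurableSet_lt hM hD
  refine ⟨hmeas.nullMeasurableSet.congr hset.symm, ?_⟩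
  have hpm : MeasurableSet {p : ℝ × ℝ | p.1 < p.2} := measurableSet_lt measurable_fst measurable_snd
  have h1 : P {ω | M ω < D ω} = P.map (fun ω => (M ω, D ω)) {p : ℝ × ℝ | p.1 < p.2} := by
    rw [Measure.map_apply (hM.prodMk hD) hpm]
    rfl
  have := Measure.isProbabilityMeasure_map (μ := P) hD.aemeasurable
  have := Measure.isProbabilityMeasure_map (μ := P) hM.aemeasurable
  rw [measure_congr hset, h1,
    (indepFun_iff_map_prod_eq_prod_map_map hM.aemeasurable hD.aemeasurable).1 hind,
    Measure.prod_apply hpm, hlaw]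
  refine lintegral_congr fun a => ?_
  rw [Measure.map_apply hD (measurable_prodMk_left hpm), ← hW.measure_exists_le_reverse]
  congr 1
  ext ω
  exact hDlt ω a

lemma aemeasurable_sSup_argmaxSet (hW : IsRegularBrownian W P) {σ : ℝ} (hσ : 0 < σ) :
    AEMeasurable (fun ω => sSup (argmaxSet fun s => W s ω + -σ * s)) P := by
  refine NullMeasurable.aemeasurable ?_
  exact measurable_of_Iio (δ := NullMeasurableSpace Ω P) fun t =>
    (hW.measure_sSup_argmaxSet_lt hσ t).1

lemma measurable_uncurry (hW : IsRegularBrownian W P) :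
    Measurable (fun p : ℝ≥0 × Ω => W p.1 p.2) :=
  (stronglyMeasurable_uncurry_of_continuous_of_stronglyMeasurable hW.continuous
    fun t => (hW.measurable t).stronglyMeasurable).measurable

/-- The Laplace transform of the last time of the maximum. -/
lemma lintegral_exp_sSup_argmaxSet (hW : IsRegularBrownian W P) {σ l θ : ℝ} (hσ : 0 < σ)
    (hl0 : 0 < l) (hθ : 0 < θ) (hl : l = θ * σ + θ ^ 2 / 2) :
    ∫⁻ ω, ENNReal.ofReal
      (Real.exp (-l * (sSup (argmaxSet fun s => W s ω + -σ * s) : ℝ≥0))) ∂P =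
      ENNReal.ofReal (2 * σ / (2 * σ + θ)) := by
  have := hW.isProbabilityMeasure
  have h2 : 0 < 2 * σ := by positivity
  have := isProbabilityMeasure_expMeasure h2
  have := isProbabilityMeasure_expMeasure hl0
  have hgm := hW.aemeasurable_sSup_argmaxSet hσ
  let g : Ω → ℝ≥0 := hgm.mk
  have hg : Measurable g := hgm.measurable_mk
  -- replace `exp (-l g)` by the probability that an exponential time comes after `g`
  have hA : MeasurableSet {p : Ω × ℝ | (g p.1 : ℝ) < p.2} :=
    measurableSet_lt (by fun_prop) measurable_snd
  have e1 : ∫⁻ ω, ENNReal.ofReal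
      (Real.exp (-l * (sSup (argmaxSet fun s => W s ω + -σ * s) : ℝ≥0))) ∂P =
      ∫⁻ t, P {ω | (g ω : ℝ) < t} ∂expMeasure l := by
    calc _ = ∫⁻ ω, expMeasure l {t | (g ω : ℝ) < t} ∂P := by
          refine lintegral_congr_ae ?_
          filter_upwards [hgm.ae_eq_mk] with ω hω
          rw [hω]
          exact (expMeasure_Ioi hl0 (g ω).coe_nonneg).symm
      _ = (P.prod (expMeasure l)) {p : Ω × ℝ | (g p.1 : ℝ) < p.2} := (Measure.prod_apply hA).symm
      _ = _ := Measure.prod_apply_symm hA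
  -- Joint measurability in the exponential time, the level and the path permits the exchanges of
  -- integrals below.
  let S : Set ((ℝ × ℝ) × Ω) := {p | ∃ s ≤ p.1.1.toNNReal, p.1.2 < W s p.2 + σ * s}
  have hS : MeasurableSet S := by
    have : S = ⋃ n : ℕ, {p : (ℝ × ℝ) × Ω |
        p.1.2 < W (min (TopologicalSpace.denseSeq ℝ≥0 n) p.1.1.toNNReal) p.2 +
          σ * (min (TopologicalSpace.denseSeq ℝ≥0 n) p.1.1.toNNReal : ℝ≥0)} := by
      ext p
      have := exists_le_lt_iff_denseSeq (hW.continuous_add_mul σ p.2) p.1.2 p.1.1.toNNReal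
      rw [mem_iUnion]
      exact this
    rw [this]
    refine .iUnion fun n => measurableSet_lt (by fun_prop) ?_
    have hmin : Measurable fun p : (ℝ × ℝ) × Ω =>
      min (TopologicalSpace.denseSeq ℝ≥0 n) p.1.1.toNNReal := by fun_prop
    exact (hW.measurable_uncurry.comp (hmin.prodMk measurable_snd)).add (by fun_prop)
  have e2 : ∫⁻ t, P {ω | (g ω : ℝ) < t} ∂expMeasure l =
      ∫⁻ t, ∫⁻ a, P (Prod.mk (t, a) ⁻¹' S) ∂expMeasure (2 * σ) ∂expMeasure l := by
    refine lintegral_congr_ae ?_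
    filter_upwards [ae_nonneg_expMeasure hl0] with t ht
    have h := (hW.measure_sSup_argmaxSet_lt hσ t.toNNReal).2
    refine Eq.trans (measure_congr ?_) h
    filter_upwards [hgm.ae_eq_mk] with ω hω
    refine propext ?_
    change (g ω : ℝ) < t ↔ sSup (argmaxSet fun s => W s ω + -σ * s) < t.toNNReal
    rw [hω, Real.lt_toNNReal_iff_coe_lt]
  have e3 (a : ℝ) (ha : 0 ≤ a) : ∫⁻ t, P (Prod.mk (t, a) ⁻¹' S) ∂expMeasure l =
      ENNReal.ofReal (Real.exp (-θ * a)) := by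
    have hSa : MeasurableSet {p : ℝ × Ω | ((p.1, a), p.2) ∈ S} := by
      have : Measurable fun p : ℝ × Ω => ((p.1, a), p.2) := by fun_prop
      exact this hS
    calc _ = ((expMeasure l).prod P) {p : ℝ × Ω | ((p.1, a), p.2) ∈ S} :=
          (Measure.prod_apply hSa).symm
      _ = ∫⁻ ω, expMeasure l {t | ((t, a), ω) ∈ S} ∂P := Measure.prod_apply_symm hSa
      _ = ∫⁻ ω, expMeasure l {t | ∃ s : ℝ≥0, (s : ℝ) ≤ t ∧ a < W s ω + σ * s} ∂P := by
          refine lintegral_congr fun ω => measure_congr ?_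
          filter_upwards [ae_nonneg_expMeasure hl0] with t ht
          refine propext (exists_congr fun s => and_congr_left fun _ => ?_)
          exact Real.le_toNNReal_iff_coe_le ht
      _ = _ := hW.lintegral_expMeasure_exists_le hθ hl hl0 ha
  -- Integrating over the exponential time before the level turns the inner integral into `exp (-θ
  -- a)`.
  rw [e1, e2, lintegral_lintegral_swap
    (measurable_measure_prodMk_left hS).aemeasurable, ← lintegral_exp_expMeasure h2 hθ.le]
  refine lintegral_congr_ae ?_
  filter_upwards [ae_nonneg_expMeasure h2] with a ha
  exact e3 a ha

lemma integral_exp_sSup_argmaxSet (hW : IsRegularBrownian W P) {σ l : ℝ} (hσ : 0 < σ)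
    (hl : 0 ≤ l) :
    ∫ ω, Real.exp (-l * (sSup (argmaxSet fun s => W s ω + -σ * s) : ℝ≥0)) ∂P =
      2 / (1 + Real.sqrt (1 + 2 * l / σ ^ 2)) := by
  have := hW.isProbabilityMeasure
  -- There is no exponential time of rate `0`, so `l = 0` is treated directly.
  rcases hl.eq_or_lt with rfl | hl
  · norm_num
  have hsq : Real.sqrt (σ ^ 2 + 2 * l) = σ * Real.sqrt (1 + 2 * l / σ ^ 2) := by
    rw [← Real.sqrt_sq hσ.le, ← Real.sqrt_mul (sq_nonneg _), Real.sqrt_sq hσ.le]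
    congr 1
    field_simp
  set r := Real.sqrt (1 + 2 * l / σ ^ 2) with hr
  have hr0 : 0 ≤ r := Real.sqrt_nonneg _
  have hrr : (σ * r) ^ 2 = σ ^ 2 + 2 * l := by
    rw [← hsq, Real.sq_sqrt (by positivity)]
  have hθ : 0 < σ * r - σ := by
    have : σ ^ 2 < (σ * r) ^ 2 := by linarith
    have := lt_of_pow_lt_pow_left₀ 2 (by positivity) this
    linarith
  -- `σ r - σ` is the positive root of `θ² / 2 + σ θ = l`.
  have h := hW.lintegral_exp_sSup_argmaxSet (θ := σ * r - σ) hσ hl hθ (by nlinarith)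
  rw [integral_eq_lintegral_of_nonneg_ae (.of_forall fun _ => (Real.exp_pos _).le), h,
    ENNReal.toReal_ofReal (by positivity)]
  · have : 0 < 1 + r := by positivity
    rw [show 2 * σ + (σ * r - σ) = σ * (1 + r) by ring]
    field_simp
  · have := hW.aemeasurable_sSup_argmaxSet hσ
    exact AEMeasurable.aestronglyMeasurable (by fun_prop)

end IsRegularBrownian
end

theorem proposition4p3 {Ω : Type*} [MeasurableSpace Ω] (P : Measure Ω)
    (W : ℝ≥0 → Ω → ℝ) (hW : IsBrownianReal W P) (σ : ℝ) (hσ : 0 < σ) :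
    -- almost surely the global maximum is attained, and the set of times where it is attained
    -- is bounded, so that `g` is a genuine supremum; and `g` is a random variable
    (∀ᵐ ω ∂P, (maxTimes (geomBM σ W) ω).Nonempty ∧ BddAbove (maxTimes (geomBM σ W) ω)) ∧
    AEMeasurable (timeOfMax (geomBM σ W)) P ∧
    -- the Laplace transform of `g`
    (∀ l : ℝ, 0 ≤ l →
      ∫ ω, Real.exp (-l * (timeOfMax (geomBM σ W) ω : ℝ)) ∂P
        = 2 / (1 + Real.sqrt (1 + 2 * l / σ ^ 2))) ∧
    -- it characterizes the law of `g` among the probability measures on `[0, ∞)`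
    (∀ ν : Measure ℝ≥0, IsProbabilityMeasure ν →
      (∀ l : ℝ, 0 ≤ l →
        ∫ x : ℝ≥0, Real.exp (-l * (x : ℝ)) ∂ν = 2 / (1 + Real.sqrt (1 + 2 * l / σ ^ 2))) →
      ν = P.map (timeOfMax (geomBM σ W))) := by
  obtain ⟨V, hV, hWV⟩ := hW.exists_isRegularBrownian
  have := hV.isProbabilityMeasure
  have hmax : ∀ᵐ ω ∂P, maxTimes (geomBM σ W) ω = argmaxSet fun s => V s ω + -σ * s := by
    filter_upwards [hWV] with ω hω
    rw [maxTimes_geomBM hσ]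
    simp_rw [hω]
  have htime : timeOfMax (geomBM σ W) =ᵐ[P]
      fun ω => sSup (argmaxSet fun s => V s ω + -σ * s) := by
    filter_upwards [hmax] with ω hω
    rw [timeOfMax, hω]
  have hmeas : AEMeasurable (timeOfMax (geomBM σ W)) P :=
    (hV.aemeasurable_sSup_argmaxSet hσ).congr htime.symm
  have hlap (l : ℝ) (hl : 0 ≤ l) : ∫ ω, Real.exp (-l * (timeOfMax (geomBM σ W) ω : ℝ)) ∂P
      = 2 / (1 + Real.sqrt (1 + 2 * l / σ ^ 2)) := by
    rw [← hV.integral_exp_sSup_argmaxSet hσ hl]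
    refine integral_congr_ae ?_
    filter_upwards [htime] with ω hω
    rw [hω]
  refine ⟨?_, hmeas, hlap, fun ν hν h => ?_⟩
  · filter_upwards [hmax, hV.ae_tendsto_atBot hσ] with ω h1 h2
    rw [h1]
    exact ⟨argmaxSet_nonempty (hV.continuous_add_mul (-σ) ω) h2, argmaxSet_bddAbove h2⟩
  · have := Measure.isProbabilityMeasure_map hmeas
    refine Measure.ext_of_laplace fun l hl => ?_
    rw [h l hl, ← hlap l hl, integral_map hmeas]
    exact (by fun_prop : Measurable fun x : ℝ≥0 => Real.exp (-l * x)).aestronglyMeasurable
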